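/- Fix an ordinal $\alpha$ and a Noetherian topological space $(\Sigma,\theta)$ (every subset is compact). For a set $X$, let $X^{<\alpha}$ be the set of words over $X$ of ordinal length less than $\alpha$. If $X$ carries a topology $\tau$, the \emph{ordinal subword topology} on $X^{<\alpha}$ is the topology generated by declaring closed the products $F_1^{<\beta_1}\cdots F_n^{<\beta_n}$, where $n\in\mathbb N$, the $F_i$ are $\tau$-closed, the $\beta_i$ are ordinals, $F^{<\beta}$ is the set of words of length less than $\beta$ with all letters in $F$, and juxtaposition is concatenation of languages, taken inside $X^{<\alpha}$ (the empty product contains only the empty word, if there is one). Let $T$ be the set of \emph{$\alpha$-branching trees} over $\Sigma$, that is, the least fixed point of $X\mapsto 1+\Sigma\times X^{<\alpha}$: a tree is either the point $\star$, or a node with a label in $\Sigma$ and a list of children of ordinal length less than $\alpha$; every branch of a tree is finite. Let $\le$ be the \emph{tree embedding} on $T$, the least relation such that $\star\le\star$; $t\le t'$ whenever $t\le s$ for some child $s$ of $t'$; and $t\le t'$ whenever $t,t'$ are nodes with labels $a,b$ such that every $\theta$-open set containing $a$ contains $b$, and there is a strictly increasing map $h$ from the positions of the list of children of $t$ to those of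 $t'$ such that the $i$-th child of $t$ is $\le$ the $h(i)$-th child of $t'$ for every $i$. For $U\subseteq\Sigma$ and $V\subseteq T^{<\alpha}$ let $U\langle V\rangle$ be the set of trees whose root is labelled by an element of $U$ and whose list of children belongs to $V$, and let ${\uparrow}E$ be the upward closure of $E\subseteq T$ for $\le$. For a topology $\tau$ on $T$, let $\mathsf E(\tau)$ be the topology on $T$ generated by the sets ${\uparrow}U\langle V\rangle$, where $U\in\theta$ and $V$ is open in the ordinal subword topology on $T^{<\alpha}$ associated with $\tau$. The map $\mathsf E$ is monotone for inclusion of topologies, and the \emph{ordinal tree topology} on $T$ is its least fixed point. \textbf{Theorem.} The set $T$ of $\alpha$-branching trees over $\Sigma$, endowed with the ordinal tree topology, is a Noetherian space. (The ordinal tree topology satisfies $\mathsf E(\tau)=\tau$ and is contained in every topology with this property.) -/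

import Mathlib

open scoped Topology

universe u v

/-- Words of ordinal length less than `α` over the alphabet `X`: the set `X^{<α}`. The letters of
a word of length `len` are indexed by the ordinals below `len`. -/
structure OrdWord (α : Ordinal.{v}) (X : Type u) where
  len : Ordinal.{v}
  len_lt : len < α
  letter : Set.Iio len → X

namespace OrdWord

variable {α : Ordinal.{v}} {X : Type u}

/-- The prefix of `w` of length `γ`. -/
def take (w : OrdWord α X) (γ : Ordinal.{v}) (h : γ ≤ w.len) : OrdWord α X where
  len := γ
  len_lt := h.trans_lt w.len_lt
  letter i := w.letter ⟨i.1, lt_of_lt_of_le i.2 h⟩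

/-- The suffix of `w` that remains after its first `γ` letters are removed. -/
noncomputable def drop (w : OrdWord α X) (γ : Ordinal.{v}) : OrdWord α X where
  len := w.len - γ
  len_lt := (Ordinal.sub_le_self w.len γ).trans_lt w.len_lt
  letter i := w.letter ⟨γ + i.1, Ordinal.lt_sub.1 i.2⟩

/-- The concatenation `A B = {u v | u ∈ A, v ∈ B}`, within the words of length less than `α`:
`w` belongs to it when `w` can be cut at some position `γ` into a prefix in `A` and a suffix
in `B`. -/
def concat (A B : Set (OrdWord α X)) : Set (OrdWord α X) :=
  {w | ∃ (γ : Ordinal.{v}) (h : γ ≤ w.len), w.take γ h ∈ A ∧ w.drop γ ∈ B}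

/-- `F^{<β}`: the words of length less than `β` with all of their letters in `F`. -/
def power (F : Set X) (β : Ordinal.{v}) : Set (OrdWord α X) :=
  {w | w.len < β ∧ ∀ i, w.letter i ∈ F}

/-- The product `F₁^{<β₁} ⋯ Fₙ^{<βₙ}`. The empty product contains the empty word only. -/
def product : List (Set X × Ordinal.{v}) → Set (OrdWord α X)
  | [] => {w | w.len = 0}
  | p :: L => concat (power p.1 p.2) (product L)

/-- The ordinal subword topology on `X^{<α}`, where `X` carries the topology `θ`: it is generated
by declaring closed the products `F₁^{<β₁} ⋯ Fₙ^{<βₙ}`, where the `Fᵢ` are closed in `θ`. -/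
@[reducible] def subwordTopology (θ : TopologicalSpace X) : TopologicalSpace (OrdWord α X) :=
  TopologicalSpace.generateFrom
    {O | ∃ L : List (Set X × Ordinal.{v}), (∀ p ∈ L, IsClosed[θ] p.1) ∧ O = (product L)ᶜ}

end OrdWord

/-- The `α`-branching trees over `S`: the least fixed point of `X ↦ 1 + S × X^{<α}`. A tree is
either the single point `star`, or a node with a label in `S` and a list of children of ordinal
length `len < α`. -/
inductive OrdTree (α : Ordinal.{v}) (S : Type u) : Type (max u (v + 1))
  | star : OrdTree α S
  | node (a : S) (len : Ordinal.{v}) (len_lt : len < α)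
      (child : Set.Iio len → OrdTree α S) : OrdTree α S

namespace OrdTree

variable {α : Ordinal.{v}} {S : Type u}

/-- The tree with root label `a` and list of children `w`. -/
def ofWord (a : S) (w : OrdWord α (OrdTree α S)) : OrdTree α S :=
  node a w.len w.len_lt w.letter

/-- The tree embedding relation. Labels are compared in the specialisation preorder of `S`:
`a` is below `b` when every open set that contains `a` contains `b`. Lists of children are compared
by the word embedding: there is a strictly increasing map of positions such that each child embeds
into its image. -/
inductive Embeds [TopologicalSpace S] : OrdTree α S → OrdTree α S → Prop
  | star : Embeds star star
  | node (a b : S) (len : Ordinal.{v}) (len_lt : len < α) (child : Set.Iio len → OrdTree α S)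
      (len' : Ordinal.{v}) (len_lt' : len' < α) (child' : Set.Iio len' → OrdTree α S)
      (hab : ∀ O : Set S, IsOpen O → a ∈ O → b ∈ O)
      (g : Set.Iio len → Set.Iio len') (hg : StrictMono g)
      (hchild : ∀ i, Embeds (child i) (child' (g i))) :
      Embeds (node a len len_lt child) (node b len' len_lt' child')
  | child (t : OrdTree α S) (b : S) (len' : Ordinal.{v}) (len_lt' : len' < α)
      (child' : Set.Iio len' → OrdTree α S) (j : Set.Iio len') (h : Embeds t (child' j)) :
      Embeds t (node b len' len_lt' child')

/-- The upward closure of a set of trees for the tree embedding. -/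
def upClosure [TopologicalSpace S] (E : Set (OrdTree α S)) : Set (OrdTree α S) :=
  {t | ∃ s ∈ E, Embeds s t}

/-- `U⟨V⟩`: the trees whose root is labelled by an element of `U` and whose list of children
belongs to `V`. -/
def rooted (U : Set S) (V : Set (OrdWord α (OrdTree α S))) : Set (OrdTree α S) :=
  {t | ∃ a ∈ U, ∃ w ∈ V, t = ofWord a w}

/-- The map that sends a topology `τ` on the trees to the topology generated by the sets `↑U⟨V⟩`,
for `U` open in `S` and `V` open in the ordinal subword topology of `τ`. -/
@[reducible] def expander [TopologicalSpace S] (τ : TopologicalSpace (OrdTree α S)) :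
    TopologicalSpace (OrdTree α S) :=
  TopologicalSpace.generateFrom
    {O | ∃ (U : Set S) (V : Set (OrdWord α (OrdTree α S))),
      IsOpen U ∧ IsOpen[OrdWord.subwordTopology τ] V ∧ O = upClosure (rooted U V)}

theorem expander_mono [TopologicalSpace S] : Monotone (expander (α := α) (S := S)) := by
  intro τ σ h
  refine TopologicalSpace.generateFrom_anti ?_
  rintro O ⟨U, V, hU, hV, rfl⟩
  refine ⟨U, V, hU, ?_, rfl⟩
  have key : OrdWord.subwordTopology (α := α) τ ≤ OrdWord.subwordTopology σ := by
    refine TopologicalSpace.generateFrom_anti ?_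
    rintro P ⟨L, hL, rfl⟩
    exact ⟨L, fun p hp => (hL p hp).mono h, rfl⟩
  exact key V hV

/-- The ordinal tree topology: the least fixed point of `expander` for the inclusion of families
of open sets. Mathlib orders topologies the other way round (`τ ≤ σ` means that every `σ`-open set
is `τ`-open), so that it is the greatest fixed point in Mathlib's order. -/
@[reducible] noncomputable def treeTopology (α : Ordinal.{v}) (S : Type u) [TopologicalSpace S] :
    TopologicalSpace (OrdTree α S) :=
  OrderHom.gfp ⟨expander, expander_mono⟩

end OrdTree

/-! A generated topology is Noetherian once no sequence of generators is bad, so a minimal bad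
sequence argument applies to generators graded by depth (`exists_isBadSeq_noetherianSpace`). It is
used twice: for words, where the depth of a product is its number of factors, and for trees, where
the depth of `↑U⟨V⟩` is a finite stage at which `V` is open.

Iterating `expander` finitely often from the indiscrete topology suffices. The topology `stageLimit`
generated by these stages is Noetherian, so its open sets are compact and each is already open at a
finite stage. Hence every open set of `expander stageLimit` is open in `stageLimit`, which therefore
contains the least fixed point; a topology coarser than a Noetherian one is Noetherian. -/

open TopologicalSpace Filter

/-! ### Subbases and minimal bad sequences -/

section BadSequences

/-- A sequence of sets is bad if each of them has a point that lies in none of the previous ones. -/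
def IsBadSeq {Y : Type*} (O : ℕ → Set Y) : Prop :=
  ∀ i, ∃ x ∈ O i, ∀ j < i, x ∉ O j

/-- A consequence of Alexander's subbasis theorem. -/
theorem noetherianSpace_generateFrom {Y : Type*} {B : Set (Set Y)}
    (h : ∀ O : ℕ → Set Y, (∀ i, O i ∈ B) → ¬ IsBadSeq O) :
    @NoetherianSpace Y (generateFrom B) := by
  let _ : TopologicalSpace Y := generateFrom B
  refine noetherianSpace_iff_isCompact.2 fun s => isCompact_generateFrom rfl fun P hP hs => ?_
  by_contra! hfin
  obtain ⟨f, hf, hf'⟩ := exists_seq_of_forall_finset_exists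
    (fun p : Set Y × Y => p.1 ∈ P ∧ p.2 ∈ p.1) (fun p q => q.2 ∉ p.1) (by
      intro F hF
      have := hfin (Prod.fst '' (F : Set (Set Y × Y)))
        (by rintro _ ⟨p, hp, rfl⟩; exact (hF p hp).1) (F.finite_toSet.image _)
      obtain ⟨x, hx, hx'⟩ := Set.not_subset.1 this
      obtain ⟨O, hO, hxO⟩ := hs hx
      exact ⟨(O, x), ⟨hO, hxO⟩, fun p hp hxp => hx' ⟨p.1, ⟨p, hp, rfl⟩, hxp⟩⟩)
  exact h (fun i => (f i).1) (fun i => hP (hf i).1) fun i =>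
    ⟨(f i).2, (hf i).2, fun j hj => hf' j i hj⟩

/-- Every sequence in a Noetherian space has a subsequence that converges to each of its terms. -/
theorem exists_subseq_eventually_mem {Y : Type*} [TopologicalSpace Y] [NoetherianSpace Y]
    (x : ℕ → Y) : ∃ g : ℕ → ℕ, StrictMono g ∧
      ∀ U : Set Y, IsOpen U → ∀ n, x (g n) ∈ U → ∀ᶠ m in atTop, x (g m) ∈ U := by
  obtain ⟨C, hC, hmin⟩ := wellFounded_lt.has_min
    {C : Closeds Y | ∃ᶠ n in atTop, x n ∈ C} ⟨⊤, Frequently.of_forall fun _ => trivial⟩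
  obtain ⟨g, hg, hgC⟩ := extraction_of_frequently_atTop hC
  refine ⟨g, hg, fun U hU n hn => ?_⟩
  have hlt : C ⊓ ⟨Uᶜ, hU.isClosed_compl⟩ < C := by
    refine lt_of_le_of_ne inf_le_left fun h => ?_
    have hn' : x (g n) ∈ C := hgC n
    rw [← h] at hn'
    exact hn'.2 hn
  have hev : ∀ᶠ n in atTop, x n ∉ C ⊓ ⟨Uᶜ, hU.isClosed_compl⟩ :=
    not_frequently.1 fun h => hmin _ h hlt
  refine (hg.tendsto_atTop.eventually hev).mono fun m hm => ?_
  by_contra hU'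
  exact hm ⟨hgC m, hU'⟩

/-- Two sequences of points of Noetherian spaces have common indices `m < n` such that the `n`-th
points lie in given open neighbourhoods of the `m`-th points. -/
theorem exists_lt_mem_and_mem {Y Z : Type*} [TopologicalSpace Y] [NoetherianSpace Y]
    [TopologicalSpace Z] [NoetherianSpace Z] (x : ℕ → Y) (z : ℕ → Z) (U : ℕ → Set Y)
    (V : ℕ → Set Z) (hU : ∀ n, IsOpen (U n)) (hV : ∀ n, IsOpen (V n)) (hx : ∀ n, x n ∈ U n)
    (hz : ∀ n, z n ∈ V n) : ∃ m n, m < n ∧ x n ∈ U m ∧ z n ∈ V m := by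
  obtain ⟨g, hg, hgx⟩ := exists_subseq_eventually_mem x
  obtain ⟨k, hk, hkz⟩ := exists_subseq_eventually_mem fun n => z (g n)
  have h1 := hk.tendsto_atTop.eventually (hgx _ (hU _) (k 0) (hx _))
  have h2 := hkz _ (hV _) 0 (hz _)
  obtain ⟨n, ⟨hn1, hn2⟩, hn⟩ := ((h1.and h2).and (eventually_gt_atTop 0)).exists
  exact ⟨g (k 0), g (k n), hg (hk hn), hn1, hn2⟩

theorem not_isBadSeq_of_isOpen {Y : Type*} [TopologicalSpace Y] [NoetherianSpace Y]
    (O : ℕ → Set Y) (hO : ∀ i, IsOpen (O i)) : ¬ IsBadSeq O := by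
  intro h
  choose x hx hx' using h
  obtain ⟨m, n, hmn, h, -⟩ := exists_lt_mem_and_mem x x O O hO hO hx hx
  exact hx' n m hmn h

/-- A bad sequence which is lexicographically minimal for the depths of its terms. -/
theorem exists_minimal_isBadSeq {Y I : Type*} (O : I → Set Y) (d : I → ℕ)
    (h : ∃ c : ℕ → I, IsBadSeq fun i => O (c i)) :
    ∃ c : ℕ → I, (IsBadSeq fun i => O (c i)) ∧ ∀ p, ∀ c' : ℕ → I, (IsBadSeq fun i => O (c' i)) →
      (∀ i < p, c' i = c i) → d (c p) ≤ d (c' p) := by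
  classical
  let Bad := {c : ℕ → I // IsBadSeq fun i => O (c i)}
  have step : ∀ (c : Bad) (p : ℕ), ∃ c' : Bad, (∀ i < p, c'.1 i = c.1 i) ∧
      ∀ c'' : Bad, (∀ i < p, c''.1 i = c.1 i) → d (c'.1 p) ≤ d (c''.1 p) := by
    intro c p
    have hne : ∃ n, ∃ c' : Bad, (∀ i < p, c'.1 i = c.1 i) ∧ d (c'.1 p) = n :=
      ⟨_, c, fun _ _ => rfl, rfl⟩
    obtain ⟨c', hc', hn⟩ := Nat.find_spec hne
    exact ⟨c', hc', fun c'' hc'' => hn.trans_le (Nat.find_min' hne ⟨c'', hc'', rfl⟩)⟩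
  choose F hF hFmin using step
  obtain ⟨c₀, hc₀⟩ := h
  -- `f n` minimises the depth at `n` with earlier terms frozen. The diagonal is bad because badness
  -- at `i` involves only terms up to `i`.
  let f : ℕ → Bad := fun n => Nat.rec (F ⟨c₀, hc₀⟩ 0) (fun k c => F c (k + 1)) n
  have hf : ∀ n i, i ≤ n → (f n).1 i = (f i).1 i := by
    intro n
    induction n with
    | zero => intro i hi; obtain rfl := Nat.le_zero.1 hi; rfl
    | succ n ih =>
      intro i hi
      obtain rfl | hi := hi.eq_or_lt
      · rfl
      · exact (hF (f n) (n + 1) i hi).trans (ih i (Nat.lt_succ_iff.1 hi))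
  refine ⟨fun i => (f i).1 i, fun i => ?_, fun p c' hc' hag => ?_⟩
  · obtain ⟨x, hx, hx'⟩ := (f i).2 i
    refine ⟨x, hx, fun j hj => ?_⟩
    have := hx' j hj
    dsimp only at this ⊢
    rwa [hf i j hj.le] at this
  · cases p with
    | zero => exact hFmin ⟨c₀, hc₀⟩ 0 ⟨c', hc'⟩ (by simp)
    | succ p =>
      refine hFmin (f p) (p + 1) ⟨c', hc'⟩ fun i hi => ?_
      rw [hf p i (Nat.lt_succ_iff.1 hi)]
      exact hag i hi

/-- The topological minimal bad sequence argument: the members of smaller depth, each restricted to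
the complement of the members that come before, generate a Noetherian topology. -/
theorem exists_isBadSeq_noetherianSpace {Y I : Type*} (O : I → Set Y) (d : I → ℕ)
    (h : ∃ c : ℕ → I, IsBadSeq fun i => O (c i)) :
    ∃ c : ℕ → I, (IsBadSeq fun i => O (c i)) ∧ ∃ θ : TopologicalSpace Y, @NoetherianSpace Y θ ∧
      ∀ i e, d e < d (c i) → IsOpen[θ] (O e ∩ {y | ∀ j < i, y ∉ O (c j)}) := by
  obtain ⟨c, hc, hmin⟩ := exists_minimal_isBadSeq O d h
  refine ⟨c, hc, generateFrom {W | ∃ i e, d e < d (c i) ∧ W = O e ∩ {y | ∀ j < i, y ∉ O (c j)}},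
    noetherianSpace_generateFrom fun W hW hbad => ?_,
    fun i e he => isOpen_generateFrom_of_mem ⟨i, e, he, rfl⟩⟩
  choose k e he hWe using hW
  -- Following `c` below `p` with `e ∘ g` contradicts minimality at `p`. For badness, `k` must be
  -- monotone along `g`: a point avoiding the first `k` terms for the later index also does so for
  -- the earlier one, so avoiding the earlier `W` means avoiding its `O e`.
  obtain ⟨g, hg⟩ := (wellQuasiOrdered_le (α := ℕ)).exists_monotone_subseq k
  let p := k (g 0)
  let c' : ℕ → I := fun i => if i < p then c i else e (g (i - p))
  have hc' : IsBadSeq fun i => O (c' i) := by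
    intro i
    by_cases hi : i < p
    · obtain ⟨x, hx, hx'⟩ := hc i
      refine ⟨x, by simpa [c', hi] using hx, fun j hj => ?_⟩
      simpa [c', hj.trans hi] using hx' j hj
    · obtain ⟨x, hx, hx'⟩ := hbad (g (i - p))
      rw [hWe] at hx
      refine ⟨x, by simpa [c', hi] using hx.1, fun j hj => ?_⟩
      by_cases hjp : j < p
      · simpa [c', hjp] using hx.2 j (hjp.trans_le (hg 0 _ (Nat.zero_le _)))
      · have hlt : j - p < i - p := by omega
        have := hx' (g (j - p)) (g.strictMono hlt)
        rw [hWe] at this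
        have hkle := hg _ _ hlt.le
        simp only [c', hjp, if_false]
        exact fun hxe => this ⟨hxe, fun l hl => hx.2 l (hl.trans_le hkle)⟩
  have := hmin p c' hc' fun i hi => by simp [c', hi]
  have h2 := he (g 0)
  simp only [c', lt_irrefl, if_false, Nat.sub_self] at this
  exact absurd h2 (not_lt.2 this)

end BadSequences

/-! ### The subword topology is Noetherian -/

namespace OrdWord

theorem ext_letter {α : Ordinal.{v}} {X : Type u} {w w' : OrdWord α X} (h : w.len = w'.len)
    (hl : ∀ i (hi : i < w.len) (hi' : i < w'.len), w.letter ⟨i, hi⟩ = w'.letter ⟨i, hi'⟩) :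
    w = w' := by
  obtain ⟨l, hlt, f⟩ := w
  obtain ⟨l', hlt', f'⟩ := w'
  obtain rfl : l = l' := h
  congr
  funext i
  exact hl i.1 i.2 i.2

theorem letter_congr {α : Ordinal.{v}} {X : Type u} (w : OrdWord α X) {i j : Ordinal.{v}}
    (hi : i < w.len) (hj : j < w.len) (h : i = j) : w.letter ⟨i, hi⟩ = w.letter ⟨j, hj⟩ := by
  subst h; rfl

theorem drop_drop {α : Ordinal.{v}} {X : Type u} (w : OrdWord α X) (γ δ : Ordinal.{v}) :
    (w.drop γ).drop δ = w.drop (γ + δ) :=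
  ext_letter (Ordinal.sub_sub _ _ _) fun _ _ _ => w.letter_congr _ _ (add_assoc _ _ _).symm

/-- Removing a prefix empties the factors before the cut and shortens the one containing it. -/
theorem drop_mem_product {α : Ordinal.{v}} {X : Type u} (L : List (Set X × Ordinal.{v}))
    (w : OrdWord α X) (hw : w ∈ product L) (δ : Ordinal.{v}) : w.drop δ ∈ product L := by
  induction L generalizing w δ with
  | nil =>
    change w.len = 0 at hw
    change w.len - δ = 0
    simp [hw]
  | cons p L ih =>
    obtain ⟨γ, hγ, ⟨hlt, hF⟩, hL⟩ := hw
    obtain hδ | hδ := le_total δ γ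
    · refine ⟨γ - δ, ?_, ⟨(Ordinal.sub_le_self γ δ).trans_lt hlt, fun i => ?_⟩, ?_⟩
      · rw [Ordinal.sub_le]
        change γ ≤ δ + (w.len - δ)
        rwa [Ordinal.add_sub_cancel_of_le (hδ.trans hγ)]
      · exact hF ⟨δ + i.1, Ordinal.lt_sub.1 i.2⟩
      · rw [drop_drop, Ordinal.add_sub_cancel_of_le hδ]
        exact hL
    · refine ⟨0, zero_le, ⟨zero_le.trans_lt hlt, fun i => absurd (Set.mem_Iio.1 i.2) not_lt_zero⟩, ?_⟩
      rw [drop_drop, add_zero, ← Ordinal.add_sub_cancel_of_le hδ, ← drop_drop]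
      exact ih _ hL _

theorem drop_mem_product_of_le {α : Ordinal.{v}} {X : Type u} {L : List (Set X × Ordinal.{v})}
    {w : OrdWord α X} {γ δ : Ordinal.{v}} (h : γ ≤ δ) (hw : w.drop γ ∈ product L) :
    w.drop δ ∈ product L := by
  rw [← Ordinal.add_sub_cancel_of_le h, ← drop_drop]
  exact drop_mem_product L _ hw _

/-- A first factor cannot extend past a letter outside `p.1`, and stopping earlier leaves a longer
suffix, which is no easier to place in `product L`. So the obstruction is either such a letter with
its suffix, or the length bound alone. -/
theorem notMem_product_cons_iff {α : Ordinal.{v}} {X : Type u} {p : Set X × Ordinal.{v}}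
    {L : List (Set X × Ordinal.{v})} {w : OrdWord α X} :
    w ∉ product (p :: L) ↔ (∃ i : Set.Iio w.len, w.letter i ∉ p.1 ∧ w.drop i.1 ∉ product L) ∨
      ∀ γ < p.2, γ ≤ w.len → w.drop γ ∉ product L := by
  constructor
  · intro hw
    by_contra! hcon
    obtain ⟨hletter, γ, hγ, hγw, hdrop⟩ := hcon
    have hex : ∃ i : Ordinal.{v}, ∃ h : i < w.len, i < γ ∧ w.letter ⟨i, h⟩ ∉ p.1 := by
      by_contra! hall
      exact hw ⟨γ, hγw, ⟨hγ, fun i => hall i.1 _ i.2⟩, hdrop⟩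
    obtain ⟨i, ⟨hi, hiγ, hip⟩, hmin⟩ := wellFounded_lt.has_min
      {i : Ordinal.{v} | ∃ h : i < w.len, i < γ ∧ w.letter ⟨i, h⟩ ∉ p.1} hex
    refine hw ⟨i, hi.le, ⟨hiγ.trans hγ, fun j => ?_⟩, hletter ⟨i, hi⟩ hip⟩
    by_contra hj
    exact hmin j.1 ⟨j.2.trans hi, j.2.trans hiγ, hj⟩ j.2
  · rintro (⟨i, hip, hi⟩ | h) ⟨γ, hγ, ⟨hlt, hF⟩, hL⟩
    · refine hi (drop_mem_product_of_le (not_lt.1 fun hiγ => hip ?_) hL)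
      exact hF ⟨i.1, hiγ⟩
    · exact h γ hlt hγ hL

/-- The words over a Noetherian space form a Noetherian space. -/
theorem noetherianSpace_subwordTopology {α : Ordinal.{v}} {X : Type u} [τ : TopologicalSpace X]
    [NoetherianSpace X] : @NoetherianSpace (OrdWord α X) (subwordTopology τ) := by
  refine noetherianSpace_generateFrom fun O hO hbad => ?_
  choose L hL hOL using hO
  obtain ⟨c, hc, θ, hθ, hopen⟩ := exists_isBadSeq_noetherianSpace
    (fun L : {L : List (Set X × Ordinal.{v}) // ∀ p ∈ L, IsClosed p.1} =>
      (product L.1 : Set (OrdWord α X))ᶜ)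
    (fun L => L.1.length) ⟨fun i => ⟨L i, hL i⟩, by simpa only [← hOL] using hbad⟩
  choose w hw hw' using hc
  replace hw : ∀ i, w i ∉ product (c i).1 := hw
  replace hw' : ∀ i, ∀ j < i, w i ∈ product (c j).1 := fun i j hj => not_not.1 (hw' i j hj)
  have hopen' : ∀ i p L', (c i).1 = p :: L' → IsOpen[θ]
      ((product L')ᶜ ∩ {y : OrdWord α X | ∀ j < i, y ∉ (product (c j).1)ᶜ}) := by
    intro i p L' h
    exact hopen i ⟨L', fun q hq => (c i).2 q (h ▸ List.mem_cons_of_mem _ hq)⟩ (by simp [h])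
  have hdrop : ∀ i γ, ∀ j < i, (w i).drop γ ∉ (product (c j).1)ᶜ := fun i γ j hj =>
    not_not.2 (drop_mem_product _ _ (hw' i j hj) γ)
  have hcases : ∃ᶠ i in atTop, (c i).1 = [] ∨
      (∃ p L', (c i).1 = p :: L' ∧
        ∃ k : Set.Iio (w i).len, (w i).letter k ∉ p.1 ∧ (w i).drop k.1 ∉ product L') ∨
      ∃ p L', (c i).1 = p :: L' ∧ ∀ γ < p.2, γ ≤ (w i).len → (w i).drop γ ∉ product L' := by
    refine Frequently.of_forall fun i => ?_
    have := hw i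
    rcases h : (c i).1 with _ | ⟨p, L'⟩
    · exact Or.inl rfl
    · rw [h, notMem_product_cons_iff] at this
      exact Or.inr (this.imp (fun h => ⟨p, L', rfl, h⟩) fun h => ⟨p, L', rfl, h⟩)
  rw [frequently_or_distrib, frequently_or_distrib] at hcases
  rcases hcases with h | h | h <;> obtain ⟨φ, hφ, h⟩ := extraction_of_frequently_atTop h
  · have h1 := hw' _ _ (hφ zero_lt_one)
    rw [h 0, ← h 1] at h1
    exact hw _ h1
  · choose p L' hcp k hk hkL using h
    have hp : ∀ n, IsOpen (p n).1ᶜ := fun n =>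
      ((c (φ n)).2 _ (hcp n ▸ List.mem_cons_self)).isOpen_compl
    obtain ⟨m, n, hmn, h1, h2⟩ := exists_lt_mem_and_mem (fun n => (w (φ n)).letter (k n))
      (fun n => (w (φ n)).drop (k n).1) _ _ hp (fun n => hopen' _ _ _ (hcp n)) hk
      fun n => ⟨hkL n, hdrop _ _⟩
    have h3 := hw' _ _ (hφ hmn)
    rw [hcp m] at h3
    exact notMem_product_cons_iff.2 (Or.inl ⟨k n, h1, h2.1⟩) h3
  · choose p' L'' hcp' hB' using h
    obtain ⟨g, hg⟩ := (wellQuasiOrdered_le (α := Ordinal.{v})).exists_monotone_subseq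
      fun n => (p' n).2
    obtain ⟨ψ, hψ, p, L', hcp, hB, hβ⟩ : ∃ ψ : ℕ → ℕ, StrictMono ψ ∧
        ∃ (p : ℕ → Set X × Ordinal.{v}) (L' : ℕ → List (Set X × Ordinal.{v})),
          (∀ n, (c (ψ n)).1 = p n :: L' n) ∧ (∀ n, ∀ γ < (p n).2, γ ≤ (w (ψ n)).len →
            (w (ψ n)).drop γ ∉ product (L' n)) ∧ ∀ m n, m ≤ n → (p m).2 ≤ (p n).2 :=
      ⟨φ ∘ g, hφ.comp g.strictMono, p' ∘ g, L'' ∘ g, fun n => hcp' _, fun n => hB' _, hg⟩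
    -- A zero exponent would make the product empty, yet the next word belongs to it.
    have hpos : ∀ n, 0 < (p n).2 := by
      refine fun n => pos_iff_ne_zero.2 fun h0 => ?_
      have h3 := hw' _ _ (hψ n.lt_succ_self)
      rw [hcp n] at h3
      exact notMem_product_cons_iff.2
        (Or.inr fun γ hγ => absurd (h0 ▸ hγ) not_lt_zero) h3
    -- For some `n`, the `n`-th open set is covered by the previous ones.
    have hgood := not_isBadSeq_of_isOpen _ fun n => hopen' _ _ _ (hcp n)
    unfold IsBadSeq at hgood
    push Not at hgood
    obtain ⟨n, hn⟩ := hgood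
    have hsup : ∀ m, ∃ γ : Ordinal.{v}, m < n →
        γ < (p m).2 ∧ γ ≤ (w (ψ n)).len ∧ (w (ψ n)).drop γ ∈ product (L' m) := by
      intro m
      by_cases hmn : m < n
      · have h3 := hw' _ _ (hψ hmn)
        rw [hcp m] at h3
        by_contra! hcon
        refine notMem_product_cons_iff.2 (Or.inr fun γ h1 h2 h4 => ?_) h3
        exact (hcon γ).2 h1 h2 h4
      · exact ⟨0, fun h => absurd h hmn⟩
    choose γ hγ using hsup
    -- A finite supremum stays below the `n`-th exponent, so the suffix at `δ` avoids `product (L'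
    -- n)`; but it lies beyond every `γ m`, hence in every earlier `product (L' m)`.
    let δ := (Finset.range n).sup γ
    have hδp : δ < (p n).2 := (Finset.sup_lt_iff (hpos n)).2 fun m hm =>
      (hγ m (Finset.mem_range.1 hm)).1.trans_le (hβ _ _ (Finset.mem_range.1 hm).le)
    have hδw : δ ≤ (w (ψ n)).len := Finset.sup_le fun m hm => (hγ m (Finset.mem_range.1 hm)).2.1
    obtain ⟨m, hmn, hm⟩ := hn ((w (ψ n)).drop δ) ⟨hB n δ hδp hδw, hdrop _ _⟩
    exact hm.1 (drop_mem_product_of_le (Finset.le_sup (Finset.mem_range.2 hmn)) (hγ m hmn).2.2)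

end OrdWord

/-! ### Traces of open sets on a subset -/

theorem exists_isOpen_agreeing_on {Y : Type*} {B : Set (Set Y)} {θ : TopologicalSpace Y} {H : Set Y}
    (h : ∀ G ∈ B, ∃ G', IsOpen[θ] G' ∧ ∀ x ∈ H, (x ∈ G ↔ x ∈ G')) {G : Set Y}
    (hG : IsOpen[generateFrom B] G) : ∃ G', IsOpen[θ] G' ∧ ∀ x ∈ H, (x ∈ G ↔ x ∈ G') := by
  induction hG with
  | basic G hG => exact h G hG
  | univ => exact ⟨Set.univ, isOpen_univ, fun _ _ => Iff.rfl⟩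
  | inter G₁ G₂ _ _ ih₁ ih₂ =>
    obtain ⟨G₁', h₁, h₁'⟩ := ih₁
    obtain ⟨G₂', h₂, h₂'⟩ := ih₂
    exact ⟨G₁' ∩ G₂', h₁.inter h₂, fun x hx => and_congr (h₁' x hx) (h₂' x hx)⟩
  | sUnion C _ ih =>
    choose! F hF hF' using ih
    refine ⟨⋃ G ∈ C, F G, isOpen_biUnion hF, fun x hx => ?_⟩
    simp only [Set.mem_sUnion, Set.mem_iUnion, exists_prop]
    exact exists_congr fun G => and_congr_right fun hG => hF' G hG x hx

namespace OrdWord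

/-- Each closed factor can be replaced by a `θ`-closed set with the same trace on `H`, since cutting
a word introduces no new letters. -/
theorem exists_isOpen_subwordTopology_agreeing_on {α : Ordinal.{v}} {X : Type u}
    {τ θ : TopologicalSpace X} {H : Set X}
    (h : ∀ G, IsOpen[τ] G → ∃ G', IsOpen[θ] G' ∧ ∀ x ∈ H, (x ∈ G ↔ x ∈ G'))
    {V : Set (OrdWord α X)} (hV : IsOpen[subwordTopology τ] V) :
    ∃ V', IsOpen[subwordTopology θ] V' ∧
      ∀ w ∈ {w : OrdWord α X | ∀ i, w.letter i ∈ H}, (w ∈ V ↔ w ∈ V') := by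
  refine exists_isOpen_agreeing_on ?_ hV
  rintro _ ⟨L, hL, rfl⟩
  obtain ⟨L', hL', hLL'⟩ : ∃ L' : List (Set X × Ordinal.{v}), (∀ p ∈ L', IsClosed[θ] p.1) ∧
      ∀ w ∈ {w : OrdWord α X | ∀ i, w.letter i ∈ H}, (w ∈ product L ↔ w ∈ product L') := by
    induction L with
    | nil => exact ⟨[], by simp, fun _ _ => Iff.rfl⟩
    | cons p L ih =>
      obtain ⟨L', hL', hLL'⟩ := ih fun q hq => hL q (List.mem_cons_of_mem _ hq)
      obtain ⟨G, hG, hG'⟩ := h _ (hL p List.mem_cons_self).isOpen_compl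
      refine ⟨(Gᶜ, p.2) :: L', ?_, fun w hw => ?_⟩
      · intro q hq
        obtain rfl | hq := List.mem_cons.1 hq
        · exact ⟨by simpa using hG⟩
        · exact hL' q hq
      · refine exists_congr fun γ => exists_congr fun hγ => and_congr ?_ ?_
        · refine and_congr_right fun _ => forall_congr' fun i => ?_
          exact not_iff_not.1 ((hG' _ (hw _)).trans not_not.symm)
        · exact hLL' _ fun i => hw _
  exact ⟨(product L')ᶜ, isOpen_generateFrom_of_mem ⟨L', hL', rfl⟩,
    fun w hw => not_congr (hLL' w hw)⟩

theorem subwordTopology_mono {α : Ordinal.{v}} {X : Type u} {τ σ : TopologicalSpace X}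
    (h : τ ≤ σ) : subwordTopology (α := α) τ ≤ subwordTopology σ := by
  refine generateFrom_anti ?_
  rintro P ⟨L, hL, rfl⟩
  exact ⟨L, fun p hp => (hL p hp).mono h, rfl⟩

end OrdWord

/-! ### Tree embedding and the finite stages -/

namespace OrdTree

theorem Embeds.refl {α : Ordinal.{v}} {S : Type u} [TopologicalSpace S] (t : OrdTree α S) :
    Embeds t t := by
  induction t with
  | star => exact .star
  | node a len hlen child ih =>
    exact .node a a len hlen child len hlen child (fun _ _ h => h) id strictMono_id ih

theorem Embeds.trans {α : Ordinal.{v}} {S : Type u} [TopologicalSpace S] {r s t : OrdTree α S}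
    (hrs : Embeds r s) (hst : Embeds s t) : Embeds r t := by
  induction hst generalizing r with
  | star => exact hrs
  | node a b len hlen child len' hlen' child' hab g hg hchild ih =>
    cases hrs with
    | node c _ len₀ hlen₀ child₀ _ _ _ hca f hf hf' =>
      exact .node _ _ _ _ _ _ _ _ (fun O hO h => hab O hO (hca O hO h)) (g ∘ f) (hg.comp hf)
        fun i => ih _ (hf' i)
    | child _ _ _ _ _ j h => exact .child _ _ _ _ _ (g j) (ih j h)
  | child s b len' hlen' child' j _ ih => exact .child _ _ _ _ _ j (ih hrs)

theorem upClosure_mem_of_embeds {α : Ordinal.{v}} {S : Type u} [TopologicalSpace S]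
    {E : Set (OrdTree α S)} {s t : OrdTree α S} (hs : s ∈ upClosure E) (h : Embeds s t) :
    t ∈ upClosure E := by
  obtain ⟨r, hr, hrs⟩ := hs
  exact ⟨r, hr, hrs.trans h⟩

theorem letter_embeds_ofWord {α : Ordinal.{v}} {S : Type u} [TopologicalSpace S] (a : S)
    (w : OrdWord α (OrdTree α S)) (i : Set.Iio w.len) : Embeds (w.letter i) (ofWord a w) :=
  .child _ _ _ _ _ i (.refl _)

/-- The finite iterates of `expander` from the indiscrete topology. -/
@[reducible] def stage (α : Ordinal.{v}) (S : Type u) [TopologicalSpace S] (n : ℕ) :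
    TopologicalSpace (OrdTree α S) :=
  expander^[n] ⊤

theorem stage_succ (α : Ordinal.{v}) (S : Type u) [TopologicalSpace S] (n : ℕ) :
    stage α S (n + 1) = expander (stage α S n) :=
  Function.iterate_succ_apply' _ _ _

theorem stage_antitone (α : Ordinal.{v}) (S : Type u) [TopologicalSpace S] :
    Antitone (stage α S) :=
  expander_mono.antitone_iterate_of_map_le le_top

/-- The generators of the finite stages, with the stage that they come from. -/
def StageGenerator (α : Ordinal.{v}) (S : Type u) [TopologicalSpace S] :=
  {p : ℕ × Set (OrdTree α S) // ∃ (U : Set S) (V : Set (OrdWord α (OrdTree α S))),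
    IsOpen U ∧ IsOpen[OrdWord.subwordTopology (stage α S p.1)] V ∧ p.2 = upClosure (rooted U V)}

/-- The topology generated by all finite stages. -/
@[reducible] def stageLimit (α : Ordinal.{v}) (S : Type u) [TopologicalSpace S] :
    TopologicalSpace (OrdTree α S) :=
  generateFrom (Set.range fun e : StageGenerator α S => e.1.2)

/-- In a minimal bad sequence, the region `H i` outside the earlier terms is closed under passing to
children. There, open sets of the stage defining the `i`-th term agree with `θ`-open sets, being
built from generators of smaller depth. So child words live in a Noetherian word space, and labels
in `S`. -/
theorem noetherianSpace_stageLimit (α : Ordinal.{v}) (S : Type u) [TopologicalSpace S]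
    [NoetherianSpace S] : @NoetherianSpace _ (stageLimit α S) := by
  refine noetherianSpace_generateFrom fun O hO hbad => ?_
  choose e he using hO
  obtain ⟨c, hc, θ, hθ, hopen⟩ := exists_isBadSeq_noetherianSpace
    (fun e : StageGenerator α S => e.1.2) (fun e => e.1.1) ⟨e, by simpa only [he] using hbad⟩
  choose t ht ht' using hc
  choose U V hU hV hUV using fun i => (c i).2
  have ht₁ : ∀ i, ∃ a ∈ U i, ∃ w ∈ V i, Embeds (ofWord a w) (t i) := by
    intro i
    have := ht i
    simp only [hUV i] at this
    obtain ⟨_, ⟨a, ha, w, hw, rfl⟩, h⟩ := this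
    exact ⟨a, ha, w, hw, h⟩
  choose a ha w hw hwt using ht₁
  let H : ℕ → Set (OrdTree α S) := fun i => {y | ∀ j < i, y ∉ (c j).1.2}
  have hH : ∀ i {r s}, Embeds r s → s ∈ H i → r ∈ H i := by
    intro i r s hrs hs j hj hr
    refine hs j hj ?_
    rw [hUV j] at hr ⊢
    exact upClosure_mem_of_embeds hr hrs
  have hroot : ∀ i, ofWord (a i) (w i) ∈ H i := fun i => hH i (hwt i) (ht' i)
  have hchild : ∀ i k, (w i).letter k ∈ H i := fun i k =>
    hH i (letter_embeds_ofWord (a i) (w i) k) (hroot i)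
  have hagree : ∀ i G, IsOpen[stage α S (c i).1.1] G →
      ∃ G', IsOpen[θ] G' ∧ ∀ x ∈ H i, (x ∈ G ↔ x ∈ G') := by
    intro i G hG
    rcases hn : (c i).1.1 with _ | n
    · rw [hn] at hG
      refine ⟨G, ?_, fun _ _ => Iff.rfl⟩
      exact (le_top : θ ≤ ⊤) G hG
    · rw [hn, stage_succ] at hG
      refine exists_isOpen_agreeing_on ?_ hG
      rintro _ ⟨U, V, hU, hV, rfl⟩
      exact ⟨_, hopen i ⟨(n, _), U, V, hU, hV, rfl⟩ (hn ▸ n.lt_succ_self),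
        fun x hx => ⟨fun h => ⟨h, hx⟩, fun h => h.1⟩⟩
  choose V' hV' hVV' using fun i =>
    OrdWord.exists_isOpen_subwordTopology_agreeing_on (hagree i) (hV i)
  let _ : TopologicalSpace (OrdWord α (OrdTree α S)) := OrdWord.subwordTopology θ
  have _ : NoetherianSpace (OrdWord α (OrdTree α S)) := OrdWord.noetherianSpace_subwordTopology
  obtain ⟨m, n, hmn, h₁, h₂⟩ := exists_lt_mem_and_mem a w U V' hU hV' ha
    fun n => (hVV' n _ (hchild n)).1 (hw n)
  -- The children of the `n`-th root lie in `H n`, hence in `H m`, where `V m` and `V' m` agree; so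
  -- this root lies in the `m`-th term, contradicting `hroot`.
  refine hroot n m hmn ?_
  rw [hUV m]
  exact ⟨_, ⟨_, h₁, _, (hVV' m _ fun k j hj => hchild n k j (hj.trans hmn)).2 h₂, rfl⟩, .refl _⟩

/-! ### The limit of the finite stages absorbs `expander` -/

theorem stageLimit_le_stage (α : Ordinal.{v}) (S : Type u) [TopologicalSpace S] (n : ℕ) :
    stageLimit α S ≤ stage α S n := by
  refine le_trans ?_ (stage_antitone α S n.le_succ)
  rw [stage_succ]
  refine generateFrom_anti ?_
  rintro _ ⟨U, V, hU, hV, rfl⟩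
  exact ⟨⟨(n, _), U, V, hU, hV, rfl⟩, rfl⟩

/-- An open set is a union of stage-open sets; compactness leaves finitely many, all open at the
largest stage involved. -/
theorem exists_isOpen_stage (α : Ordinal.{v}) (S : Type u) [TopologicalSpace S]
    [NoetherianSpace S] {O : Set (OrdTree α S)} (hO : IsOpen[stageLimit α S] O) :
    ∃ n, IsOpen[stage α S n] O := by
  have hbasis : ∀ x ∈ O, ∃ n G, IsOpen[stage α S n] G ∧ x ∈ G ∧ G ⊆ O := by
    induction hO with
    | basic O h =>
      obtain ⟨⟨⟨n, O⟩, U, V, hU, hV, hO⟩, rfl⟩ := h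
      intro x hx
      refine ⟨n + 1, _, ?_, hx, subset_rfl⟩
      dsimp only at hO ⊢
      rw [stage_succ, hO]
      exact isOpen_generateFrom_of_mem ⟨U, V, hU, hV, rfl⟩
    | univ => exact fun x _ => ⟨0, Set.univ, @isOpen_univ _ (stage α S 0), trivial, subset_rfl⟩
    | inter O₁ O₂ _ _ ih₁ ih₂ =>
      rintro x ⟨hx₁, hx₂⟩
      obtain ⟨n₁, G₁, hG₁, hxG₁, hGO₁⟩ := ih₁ x hx₁
      obtain ⟨n₂, G₂, hG₂, hxG₂, hGO₂⟩ := ih₂ x hx₂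
      exact ⟨max n₁ n₂, G₁ ∩ G₂, @IsOpen.inter _ (stage α S (max n₁ n₂)) _ _
        (stage_antitone α S (le_max_left _ _) _ hG₁) (stage_antitone α S (le_max_right _ _) _ hG₂),
        ⟨hxG₁, hxG₂⟩, Set.inter_subset_inter hGO₁ hGO₂⟩
    | sUnion C _ ih =>
      rintro x ⟨O, hOC, hxO⟩
      obtain ⟨n, G, hG, hxG, hGO⟩ := ih O hOC x hxO
      exact ⟨n, G, hG, hxG, hGO.trans (Set.subset_sUnion_of_mem hOC)⟩
  let _ : TopologicalSpace (OrdTree α S) := stageLimit α S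
  have _ : NoetherianSpace (OrdTree α S) := noetherianSpace_stageLimit α S
  obtain ⟨n, G, hG, hOG, hGO⟩ := (NoetherianSpace.isCompact O).induction_on
    (p := fun s => ∃ n G, IsOpen[stage α S n] G ∧ s ⊆ G ∧ G ⊆ O)
    ⟨0, ∅, @isOpen_empty _ (stage α S 0), subset_rfl, Set.empty_subset _⟩
    (fun s s' hss' ⟨n, G, hG, hsG, hGO⟩ => ⟨n, G, hG, hss'.trans hsG, hGO⟩)
    (fun s₁ s₂ ⟨n₁, G₁, hG₁, hsG₁, hGO₁⟩ ⟨n₂, G₂, hG₂, hsG₂, hGO₂⟩ =>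
      ⟨max n₁ n₂, G₁ ∪ G₂, @IsOpen.union _ _ _ (stage α S (max n₁ n₂))
        (stage_antitone α S (le_max_left _ _) _ hG₁) (stage_antitone α S (le_max_right _ _) _ hG₂),
        Set.union_subset_union hsG₁ hsG₂, Set.union_subset hGO₁ hGO₂⟩)
    (fun x hx => by
      obtain ⟨n, G, hG, hxG, hGO⟩ := hbasis x hx
      exact ⟨G, mem_nhdsWithin_of_mem_nhds
        (IsOpen.mem_nhds (stageLimit_le_stage α S n _ hG) hxG), n, G, hG, subset_rfl, hGO⟩)
  exact ⟨n, hOG.antisymm hGO ▸ hG⟩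

/-- A product mentions finitely many closed sets, so one stage serves them all. -/
theorem exists_isOpen_subwordTopology_stage (α : Ordinal.{v}) (S : Type u) [TopologicalSpace S]
    [NoetherianSpace S] {V : Set (OrdWord α (OrdTree α S))}
    (hV : IsOpen[OrdWord.subwordTopology (stageLimit α S)] V) :
    ∀ w ∈ V, ∃ n V', IsOpen[OrdWord.subwordTopology (stage α S n)] V' ∧ w ∈ V' ∧ V' ⊆ V := by
  induction hV with
  | basic V h =>
    obtain ⟨L, hL, rfl⟩ := h
    obtain ⟨n, hn⟩ : ∃ n, ∀ p ∈ L, IsClosed[stage α S n] p.1 := by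
      induction L with
      | nil => exact ⟨0, by simp⟩
      | cons p L ih =>
        obtain ⟨n₁, h₁⟩ := ih fun q hq => hL q (List.mem_cons_of_mem _ hq)
        obtain ⟨n₂, h₂⟩ := exists_isOpen_stage α S (hL p List.mem_cons_self).isOpen_compl
        refine ⟨max n₁ n₂, fun q hq => ?_⟩
        obtain rfl | hq := List.mem_cons.1 hq
        · exact @IsClosed.mk _ (stage α S (max n₁ n₂)) _
            (stage_antitone α S (le_max_right _ _) _ h₂)
        · exact (h₁ q hq).mono (stage_antitone α S (le_max_left _ _))
    exact fun w hw => ⟨n, _, isOpen_generateFrom_of_mem ⟨L, hn, rfl⟩, hw, subset_rfl⟩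
  | univ => exact fun w _ => ⟨0, Set.univ,
      @isOpen_univ _ (OrdWord.subwordTopology (stage α S 0)), trivial, subset_rfl⟩
  | inter V₁ V₂ _ _ ih₁ ih₂ =>
    rintro w ⟨hw₁, hw₂⟩
    obtain ⟨n₁, G₁, hG₁, hwG₁, hGV₁⟩ := ih₁ w hw₁
    obtain ⟨n₂, G₂, hG₂, hwG₂, hGV₂⟩ := ih₂ w hw₂
    exact ⟨max n₁ n₂, G₁ ∩ G₂, @IsOpen.inter _ (OrdWord.subwordTopology (stage α S (max n₁ n₂))) _ _
      (OrdWord.subwordTopology_mono (stage_antitone α S (le_max_left _ _)) _ hG₁)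
      (OrdWord.subwordTopology_mono (stage_antitone α S (le_max_right _ _)) _ hG₂),
      ⟨hwG₁, hwG₂⟩, Set.inter_subset_inter hGV₁ hGV₂⟩
  | sUnion C _ ih =>
    rintro w ⟨V, hVC, hwV⟩
    obtain ⟨n, G, hG, hwG, hGV⟩ := ih V hVC w hwV
    exact ⟨n, G, hG, hwG, hGV.trans (Set.subset_sUnion_of_mem hVC)⟩

theorem stageLimit_le_expander (α : Ordinal.{v}) (S : Type u) [TopologicalSpace S]
    [NoetherianSpace S] : stageLimit α S ≤ expander (stageLimit α S) := by
  refine le_generateFrom ?_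
  rintro _ ⟨U, V, hU, hV, rfl⟩
  let _ : TopologicalSpace (OrdTree α S) := stageLimit α S
  refine isOpen_iff_forall_mem_open.2 ?_
  rintro t ⟨_, ⟨a, ha, w, hw, rfl⟩, hwt⟩
  obtain ⟨n, V', hV', hwV', hVV'⟩ := exists_isOpen_subwordTopology_stage α S hV w hw
  refine ⟨upClosure (rooted U V'), ?_,
    isOpen_generateFrom_of_mem ⟨⟨(n, _), U, V', hU, hV', rfl⟩, rfl⟩,
    ⟨_, ⟨a, ha, w, hwV', rfl⟩, hwt⟩⟩
  rintro s ⟨_, ⟨b, hb, x, hx, rfl⟩, hxs⟩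
  exact ⟨_, ⟨b, hb, x, hVV' hx, rfl⟩, hxs⟩

end OrdTree

theorem mainTheorem5 (α : Ordinal.{v}) (S : Type u) [TopologicalSpace S]
    [TopologicalSpace.NoetherianSpace S] :
    @TopologicalSpace.NoetherianSpace (OrdTree α S) (OrdTree.treeTopology α S) ∧
    OrdTree.expander (OrdTree.treeTopology α S) = OrdTree.treeTopology α S ∧
    ∀ τ : TopologicalSpace (OrdTree α S), OrdTree.expander τ = τ →
      ∀ O : Set (OrdTree α S), IsOpen[OrdTree.treeTopology α S] O → IsOpen[τ] O := by
  refine ⟨?_, OrderHom.map_gfp ⟨OrdTree.expander, OrdTree.expander_mono⟩, fun τ hτ O hO => ?_⟩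
  · have hle : OrdTree.stageLimit α S ≤ OrdTree.treeTopology α S :=
      OrderHom.le_gfp _ (OrdTree.stageLimit_le_expander α S)
    exact @noetherianSpace_of_surjective _ _ (OrdTree.stageLimit α S) (OrdTree.treeTopology α S)
      (OrdTree.noetherianSpace_stageLimit α S) id (continuous_id_iff_le.2 hle)
      Function.surjective_id
  · have hle : τ ≤ OrdTree.treeTopology α S := OrderHom.le_gfp _ hτ.ge
    exact hle O hO
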